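/- Let $n\ge 2$, and let $G_k^{(n)}$ ($k\ge 0$) be the Gegenbauer polynomials defined by $G_0^{(n)}(t)=1$, $G_1^{(n)}(t)=t$ and $$G_k^{(n)}(t)=\frac{(2k+n-4)\,t\,G_{k-1}^{(n)}(t)-(k-1)\,G_{k-2}^{(n)}(t)}{k+n-3}\qquad(k\ge2).$$ Let $f:[-1,1]\to\mathbb R$ be a function with $f(t)=\sum_{k=0}^\infty f_kG_k^{(n)}(t)$, where the series converges uniformly on $[-1,1]$. A finite set $P=\{p_1,\dots,p_m\}\subset\mathbb S^{n-1}$ of $m$ distinct points of the unit sphere of $\mathbb R^n$ is called an $f$-design if 1. $\sum_{i=1}^m\sum_{j=1}^m G_k^{(n)}(p_i\cdot p_j)=0$ for every $k>0$ with $f_k\neq0$, and 2. for all $i\ne j$ one has $p_i\cdot p_j\in[-1,1)$ and $f(p_i\cdot p_j)=0$. For real sequences $A=(a_1,\dots,a_N)$ and $B=(b_1,\dots,b_N)$ with non-decreasing rearrangements $a_{(1)}\le\dots\le a_{(N)}$ and $b_{(1)}\le\dots\le b_{(N)}$, write $A\vartriangleright B$ if $a_{(1)}+\dots+a_{(k)}\ge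 b_{(1)}+\dots+b_{(k)}$ for all $k=1,\dots,N$; call $A$ and $B$ incomparable if neither $A\vartriangleright B$ nor $B\vartriangleright A$. For a symmetric function $\rho:S\times S\to\mathbb R$ and $X=(x_1,\dots,x_m)\in S^m$, let $R_\rho(X)$ be the sequence of the values $\rho(x_i,x_j)$, $1\le i<j\le m$. Then $X$ is called an $M$-set in $S$ with respect to $\rho$ if for every $Y\in S^m$ either $R_\rho(X)\vartriangleright R_\rho(Y)$, or $R_\rho(X)$ and $R_\rho(Y)$ are incomparable. **Theorem.** If $f_k\ge0$ for all $k\ge 0$, then every $f$-design $P=\{p_1,\dots,p_m\}$ in $\mathbb S^{n-1}$ is an $M$-set in $\mathbb S^{n-1}$ with respect to $\rho(x,y)=-f(x\cdot y)$. -/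

import Mathlib

namespace SphericalFDesign

noncomputable section

/-- The unit sphere `S^{n-1}` in `ℝ^n`. -/
abbrev Sphere (n : ℕ) : Type := Metric.sphere (0 : EuclideanSpace ℝ (Fin n)) 1

/-- The inner product `x · y` of two points of the sphere. -/
def dot {n : ℕ} (x y : Sphere n) : ℝ :=
  inner ℝ (x : EuclideanSpace ℝ (Fin n)) (y : EuclideanSpace ℝ (Fin n))

/-- The Gegenbauer polynomial `G_k^{(n)}(t)` (for `n ≥ 2`), by the recurrence
`G_k = ((2k+n-4) t G_{k-1} - (k-1) G_{k-2}) / (k+n-3)` for `k ≥ 2`, written here with `k+2`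
in place of `k`. -/
def gegenbauer (n : ℕ) : ℕ → ℝ → ℝ
  | 0, _ => 1
  | 1, t => t
  | k + 2, t =>
      ((2 * (k : ℝ) + (n : ℝ)) * t * gegenbauer n (k + 1) t
        - ((k : ℝ) + 1) * gegenbauer n k t) / ((k : ℝ) + (n : ℝ) - 1)

/-- The series `∑ c k * G_k^{(n)}` converges uniformly to `f` on `[-1, 1]`. -/
def HasGegenbauerSeries (n : ℕ) (f : ℝ → ℝ) (c : ℕ → ℝ) : Prop :=
  TendstoUniformlyOn (fun (N : ℕ) (t : ℝ) => ∑ k ∈ Finset.range N, c k * gegenbauer n k t) f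
    Filter.atTop (Set.Icc (-1 : ℝ) 1)

/-- The `k`-th moment `M_k(P)`: the sum over all ordered pairs, equal points included. -/
def moment {n : ℕ} (k : ℕ) (P : Finset (Sphere n)) : ℝ :=
  ∑ p ∈ P, ∑ q ∈ P, gegenbauer n k (dot p q)

/-- The set `D(P)` of inner products of distinct points of `P`. -/
def innerProducts {n : ℕ} (P : Finset (Sphere n)) : Set ℝ :=
  {t | ∃ p ∈ P, ∃ q ∈ P, p ≠ q ∧ dot p q = t}

/-- The set `Z_f` of zeros of `f` in `[-1, 1)`. -/
def zeroSet (f : ℝ → ℝ) : Set ℝ := {t | t ∈ Set.Ico (-1 : ℝ) 1 ∧ f t = 0}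

/-- `P` is an `f`-design, where `f = ∑ c k * G_k^{(n)}`. -/
def IsFDesign {n : ℕ} (f : ℝ → ℝ) (c : ℕ → ℝ) (P : Finset (Sphere n)) : Prop :=
  (∀ k : ℕ, 0 < k → c k ≠ 0 → moment k P = 0) ∧ innerProducts P ⊆ zeroSet f

/-- The sum of the `k` smallest entries of a finite sequence, taken up to order. -/
def sumSmallest (A : Multiset ℝ) (k : ℕ) : ℝ := ((A.sort (· ≤ ·)).take k).sum

/-- `A` majorizes `B`, for two sequences of the same length taken up to order: for every `k`
from `1` to the length, the sum of the `k` smallest entries of `A` is at least that of `B`. -/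
def Majorizes (A B : Multiset ℝ) : Prop :=
  A.card = B.card ∧ ∀ k : ℕ, 1 ≤ k → k ≤ A.card → sumSmallest B k ≤ sumSmallest A k

/-- `R_ρ(x)`: the values `ρ (x i) (x j)` for `i < j`, with multiplicity. -/
def pairValues {S : Type*} {m : ℕ} (ρ : S → S → ℝ) (x : Fin m → S) : Multiset ℝ :=
  ((Finset.univ : Finset (Fin m × Fin m)).filter (fun p => p.1 < p.2)).val.map
    (fun p => ρ (x p.1) (x p.2))

/-- Neither sequence majorizes the other. -/
def Incomparable (A B : Multiset ℝ) : Prop := ¬ Majorizes A B ∧ ¬ Majorizes B A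

/-- `x ∈ S^m` is an `M`-set in `S` with respect to `ρ`: for every `y ∈ S^m`, either `R_ρ(x)`
majorizes `R_ρ(y)`, or the two are incomparable. -/
def IsMTuple {S : Type*} {m : ℕ} (ρ : S → S → ℝ) (x : Fin m → S) : Prop :=
  ∀ y : Fin m → S,
    Majorizes (pairValues ρ x) (pairValues ρ y) ∨
      Incomparable (pairValues ρ x) (pairValues ρ y)

/-- `M(S, ρ, m)`: the `M`-sets of cardinality `m`, that is, the `m`-subsets `{x_1, …, x_m}` of
`S` such that `(x_1, …, x_m)` is an `M`-set; for symmetric `ρ` the numbering is irrelevant. -/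
def mSets (S : Type*) (ρ : S → S → ℝ) (m : ℕ) : Set (Finset S) :=
  {X | X.card = m ∧ ∀ x : Fin m ≃ {p : S // p ∈ X}, IsMTuple ρ (fun i => (x i : S))}

end

end SphericalFDesign

/-! All pair values of an `f`-design are `0`, so only the total of a competitor's values matters.
For any `m` points, positive definiteness of the Gegenbauer polynomials (`sum_gegenbauer_nonneg`)
and `c k ≥ 0` bound the energy `∑ f (y i · y j)` below by `c 0 * m ^ 2`. A design attains this
bound, and its energy is only the diagonal part `m * f 1`; hence the values `-f` of every competitor
have sum at most `0`. A sequence with such a sum can majorize the zero sequence only by being zero.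

Positive definiteness comes from zonal harmonics: in the Fischer form, pairing with `zonal x k` is,
up to a positive factor, evaluation at `x` on harmonic forms of degree `k` (`fischer_zonal`). So
`gegenbauer n k (x · y)` is a positive multiple of a Gram matrix. -/

namespace SphericalFDesign

open MvPolynomial

noncomputable section

/-! ### The Fischer bilinear form -/

/-- The Fischer bilinear form `⟨p, q⟩ = ∑ α! p_α q_α` on real polynomials. -/
def fischer {n : ℕ} :
    MvPolynomial (Fin n) ℝ →ₗ[ℝ] MvPolynomial (Fin n) ℝ →ₗ[ℝ] ℝ :=
  (basisMonomials (Fin n) ℝ).constr ℝ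
    (fun α => (∏ i, ((α i).factorial : ℝ)) • lcoeff (R := ℝ) α)

lemma fischer_monomial {n : ℕ} (α : Fin n →₀ ℕ) (a : ℝ) (q : MvPolynomial (Fin n) ℝ) :
    fischer (monomial α a) q = a * ((∏ i, ((α i).factorial : ℝ)) * coeff α q) := by
  have h : monomial α a = a • basisMonomials (Fin n) ℝ α := by
    simp [coe_basisMonomials, smul_monomial]
  rw [h, map_smul, fischer, Module.Basis.constr_basis]
  simp [lcoeff]

/-- The weights `α!` are chosen for this adjointness: raising `α i` by one multiplies `α!` by `α i +
1`, the factor produced by differentiation. -/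
lemma fischer_X_mul {n : ℕ} (i : Fin n) (p q : MvPolynomial (Fin n) ℝ) :
    fischer (X i * p) q = fischer p (pderiv i q) := by
  induction p using MvPolynomial.induction_on' with
  | monomial α a =>
    rw [X, monomial_mul, fischer_monomial, fischer_monomial, coeff_pderiv, one_mul,
      add_comm (Finsupp.single i 1) α]
    have h : (∏ j, (((α + Finsupp.single i 1 : Fin n →₀ ℕ) j).factorial : ℝ))
        = (∏ j, ((α j).factorial : ℝ)) * ((α i : ℝ) + 1) := by
      rw [← Finset.mul_prod_erase _ _ (Finset.mem_univ i),
        ← Finset.mul_prod_erase _ _ (Finset.mem_univ i)]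
      have h2 : ∏ j ∈ Finset.univ.erase i, (((α + Finsupp.single i 1 : Fin n →₀ ℕ) j).factorial : ℝ)
          = ∏ j ∈ Finset.univ.erase i, ((α j).factorial : ℝ) := by
        refine Finset.prod_congr rfl fun j hj => ?_
        simp [(Finset.ne_of_mem_erase hj).symm]
      rw [h2]
      simp [Nat.factorial_succ]
      ring
    rw [h]
    ring
  | add p q hp hq => simp [mul_add, hp, hq]

lemma fischer_self_nonneg {n : ℕ} (p : MvPolynomial (Fin n) ℝ) : 0 ≤ fischer p p := by
  have h : fischer p p = ∑ α ∈ p.support, fischer (monomial α (coeff α p)) p := by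
    conv_lhs => enter [1]; rw [p.as_sum]
    rw [map_sum, LinearMap.sum_apply]
  rw [h]
  refine Finset.sum_nonneg fun α _ => ?_
  rw [fischer_monomial, mul_left_comm]
  exact mul_nonneg (by positivity) (mul_self_nonneg _)

/-! ### Directional derivatives and the Laplacian -/

/-- The directional derivative `∑ x_i ∂_i` on polynomials. -/
def dirDeriv {n : ℕ} (x : Fin n → ℝ) :
    Derivation ℝ (MvPolynomial (Fin n) ℝ) (MvPolynomial (Fin n) ℝ) :=
  ∑ i, x i • pderiv i

lemma dirDeriv_apply {n : ℕ} (x : Fin n → ℝ) (p : MvPolynomial (Fin n) ℝ) :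
    dirDeriv x p = ∑ i, x i • pderiv i p := by
  have h := map_sum (Derivation.coeFnAddMonoidHom (R := ℝ) (A := MvPolynomial (Fin n) ℝ)
    (M := MvPolynomial (Fin n) ℝ)) (fun i => x i • pderiv i) Finset.univ
  have hp := congrFun h p
  rw [Finset.sum_apply] at hp
  exact hp

/-- The Laplacian on polynomials. -/
def laplacian {n : ℕ} : MvPolynomial (Fin n) ℝ →ₗ[ℝ] MvPolynomial (Fin n) ℝ :=
  ∑ i, (pderiv i).toLinearMap ∘ₗ (pderiv i).toLinearMap

lemma laplacian_apply {n : ℕ} (p : MvPolynomial (Fin n) ℝ) :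
    laplacian p = ∑ i, pderiv i (pderiv i p) := by
  simp [laplacian]

/-- The linear form `∑ x_i X_i`. -/
def linForm {n : ℕ} (x : Fin n → ℝ) : MvPolynomial (Fin n) ℝ := ∑ i, C (x i) * X i

/-- The quadratic form `∑ X_i ^ 2`. -/
def sumSq (n : ℕ) : MvPolynomial (Fin n) ℝ := ∑ i, X i ^ 2

lemma pderiv_linForm {n : ℕ} (x : Fin n → ℝ) (i : Fin n) :
    pderiv i (linForm x) = C (x i) := by
  rw [linForm, map_sum, Finset.sum_eq_single i]
  · simp
  · intro j _ hj
    simp [pderiv_X_of_ne hj]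
  · simp

lemma pderiv_sumSq {n : ℕ} (i : Fin n) : pderiv i (sumSq n) = 2 * X i := by
  rw [sumSq, map_sum, Finset.sum_eq_single i]
  · simp
  · intro j _ hj
    simp [pderiv_X_of_ne hj]
  · simp

lemma pderiv_comm {n : ℕ} (i j : Fin n) (p : MvPolynomial (Fin n) ℝ) :
    pderiv i (pderiv j p) = pderiv j (pderiv i p) := by
  ext α
  simp only [coeff_pderiv, Finsupp.add_apply, Finsupp.single_apply]
  by_cases h : i = j
  · subst h; rfl
  · rw [add_right_comm]
    simp [h, Ne.symm h]
    ring

lemma laplacian_dirDeriv {n : ℕ} (x : Fin n → ℝ) (p : MvPolynomial (Fin n) ℝ) :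
    laplacian (dirDeriv x p) = dirDeriv x (laplacian p) := by
  simp only [laplacian_apply, dirDeriv_apply, map_sum, Derivation.map_smul]
  rw [Finset.sum_comm]
  refine Finset.sum_congr rfl fun i _ => Finset.sum_congr rfl fun j _ => ?_
  rw [pderiv_comm j i, pderiv_comm j i]

lemma dirDeriv_linForm {n : ℕ} (x : Fin n → ℝ) (hx : ∑ i, x i ^ 2 = 1) :
    dirDeriv x (linForm x) = 1 := by
  rw [← C_1, ← hx, map_sum]
  simp [dirDeriv_apply, pderiv_linForm, smul_eq_C_mul, pow_two]

lemma dirDeriv_sumSq {n : ℕ} (x : Fin n → ℝ) : dirDeriv x (sumSq n) = 2 * linForm x := by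
  simp only [dirDeriv_apply, pderiv_sumSq, smul_eq_C_mul, linForm, Finset.mul_sum]
  exact Finset.sum_congr rfl fun i _ => by ring

lemma laplacian_linForm_mul {n : ℕ} (x : Fin n → ℝ) (p : MvPolynomial (Fin n) ℝ) :
    laplacian (linForm x * p) = linForm x * laplacian p + 2 * dirDeriv x p := by
  simp only [laplacian_apply, dirDeriv_apply, Finset.mul_sum, ← Finset.sum_add_distrib]
  refine Finset.sum_congr rfl fun i _ => ?_
  simp only [pderiv_mul, map_add, pderiv_linForm, pderiv_C, smul_eq_C_mul]
  ring

lemma laplacian_sumSq_mul {n k : ℕ} {p : MvPolynomial (Fin n) ℝ} (hp : p.IsHomogeneous k) :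
    laplacian (sumSq n * p)
      = sumSq n * laplacian p + (2 * (n : MvPolynomial (Fin n) ℝ) + 4 * k) * p := by
  have h : ∀ i : Fin n, pderiv i (pderiv i (sumSq n * p))
      = sumSq n * pderiv i (pderiv i p) + 4 * (X i * pderiv i p) + 2 * p := by
    intro i
    have h2 : pderiv i (2 : MvPolynomial (Fin n) ℝ) = 0 := by
      rw [← map_ofNat C 2, pderiv_C]
    simp only [pderiv_mul, map_add, pderiv_sumSq, pderiv_X_self, h2]
    ring
  simp only [laplacian_apply, h, Finset.sum_add_distrib, ← Finset.mul_sum, hp.sum_X_mul_pderiv]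
  simp
  ring

lemma fischer_linForm_mul {n : ℕ} (x : Fin n → ℝ) (p q : MvPolynomial (Fin n) ℝ) :
    fischer (linForm x * p) q = fischer p (dirDeriv x q) := by
  simp [linForm, dirDeriv_apply, Finset.sum_mul, ← smul_eq_C_mul, fischer_X_mul]

lemma fischer_sumSq_mul {n : ℕ} (p q : MvPolynomial (Fin n) ℝ) :
    fischer (sumSq n * p) q = fischer p (laplacian q) := by
  simp [sumSq, laplacian_apply, Finset.sum_mul, pow_two, mul_assoc, fischer_X_mul]

lemma isHomogeneous_linForm {n : ℕ} (x : Fin n → ℝ) : (linForm x).IsHomogeneous 1 :=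
  IsHomogeneous.sum _ _ _ fun i _ => isHomogeneous_C_mul_X _ i

lemma isHomogeneous_sumSq (n : ℕ) : (sumSq n).IsHomogeneous 2 :=
  IsHomogeneous.sum _ _ _ fun i _ => by simpa using (isHomogeneous_X ℝ i).pow 2

lemma isHomogeneous_dirDeriv {n k : ℕ} (x : Fin n → ℝ) {p : MvPolynomial (Fin n) ℝ}
    (hp : p.IsHomogeneous (k + 1)) : (dirDeriv x p).IsHomogeneous k := by
  rw [dirDeriv_apply]
  refine IsHomogeneous.sum _ _ _ fun i _ => ?_
  rw [smul_eq_C_mul]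
  simpa using (isHomogeneous_C (Fin n) (x i)).mul hp.pderiv

lemma eval_dirDeriv {n k : ℕ} (x : Fin n → ℝ) {p : MvPolynomial (Fin n) ℝ}
    (hp : p.IsHomogeneous k) : eval x (dirDeriv x p) = k * eval x p := by
  have h := congrArg (eval x) hp.sum_X_mul_pderiv
  simpa [dirDeriv_apply, smul_eval] using h

/-! ### Zonal harmonics -/

/-- The zonal harmonic polynomial of degree `k` with pole `x`, obtained from the recurrence of
the Gegenbauer polynomials by homogenization. -/
def zonal {n : ℕ} (x : Fin n → ℝ) : ℕ → MvPolynomial (Fin n) ℝ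
  | 0 => 1
  | 1 => linForm x
  | k + 2 => ((k : ℝ) + n - 1)⁻¹ •
      ((2 * (k : ℝ) + n) • (linForm x * zonal x (k + 1))
        - ((k : ℝ) + 1) • (sumSq n * zonal x k))

lemma gegenbauer_denom_pos {n : ℕ} (hn : 2 ≤ n) (k : ℕ) : 0 < (k : ℝ) + n - 1 := by
  have h : (2 : ℝ) ≤ n := by exact_mod_cast hn
  have h2 : (0 : ℝ) ≤ k := k.cast_nonneg
  linarith

lemma zonal_add_two {n : ℕ} (hn : 2 ≤ n) (x : Fin n → ℝ) (k : ℕ) :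
    ((k : MvPolynomial (Fin n) ℝ) + (n : MvPolynomial (Fin n) ℝ) - 1) * zonal x (k + 2)
      = (2 * k + (n : MvPolynomial (Fin n) ℝ)) * (linForm x * zonal x (k + 1)) - (k + 1) * (sumSq n * zonal x k) := by
  have h : ((k : MvPolynomial (Fin n) ℝ) + (n : MvPolynomial (Fin n) ℝ) - 1) = C ((k : ℝ) + n - 1) := by simp
  rw [zonal, h, ← smul_eq_C_mul, smul_inv_smul₀ (gegenbauer_denom_pos hn k).ne']
  simp [smul_eq_C_mul, map_ofNat C 2]

lemma isHomogeneous_zonal {n : ℕ} (x : Fin n → ℝ) (k : ℕ) : (zonal x k).IsHomogeneous k := by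
  induction k using Nat.twoStepInduction with
  | zero => exact isHomogeneous_one _ _
  | one => exact isHomogeneous_linForm x
  | more k h0 h1 =>
    rw [zonal]
    have e1 := (isHomogeneous_linForm x).mul h1
    have e2 := (isHomogeneous_sumSq n).mul h0
    rw [show 1 + (k + 1) = k + 2 by ring] at e1
    rw [show 2 + k = k + 2 by ring] at e2
    simp only [← mem_homogeneousSubmodule] at e1 e2 ⊢
    exact Submodule.smul_mem _ _
      (Submodule.sub_mem _ (Submodule.smul_mem _ _ e1) (Submodule.smul_mem _ _ e2))

/-- Differentiating the recurrence along the unit pole and inserting the two previous cases leaves a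
multiple of `zonal x (k + 2)` plus `k + 2` times the right side of the undifferentiated recurrence.
-/
lemma dirDeriv_zonal {n : ℕ} (hn : 2 ≤ n) (x : Fin n → ℝ) (hx : ∑ i, x i ^ 2 = 1) (k : ℕ) :
    dirDeriv x (zonal x (k + 1)) = (k + 1) * zonal x k := by
  have step (k : ℕ) : ((k : MvPolynomial (Fin n) ℝ) + (n : MvPolynomial (Fin n) ℝ) - 1) * dirDeriv x (zonal x (k + 2))
      = (2 * k + (n : MvPolynomial (Fin n) ℝ)) * (zonal x (k + 1) + linForm x * dirDeriv x (zonal x (k + 1)))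
        - (k + 1) * (2 * linForm x * zonal x k + sumSq n * dirDeriv x (zonal x k)) := by
    have h : ((k : MvPolynomial (Fin n) ℝ) + (n : MvPolynomial (Fin n) ℝ) - 1) = C ((k : ℝ) + n - 1) := by simp
    rw [h, ← smul_eq_C_mul, ← Derivation.map_smul, zonal,
      smul_inv_smul₀ (gegenbauer_denom_pos hn k).ne']
    have hC : (C (2 : ℝ) : MvPolynomial (Fin n) ℝ) = 2 := map_ofNat C 2
    have h2 : dirDeriv x (2 : MvPolynomial (Fin n) ℝ) = 0 := by
      rw [← hC, ← algebraMap_eq, Derivation.map_algebraMap]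
    simp [smul_eq_C_mul, hC, h2, dirDeriv_linForm x hx, dirDeriv_sumSq]
    ring
  have ne (k : ℕ) : ((k : MvPolynomial (Fin n) ℝ) + (n : MvPolynomial (Fin n) ℝ) - 1) ≠ 0 := by
    have h : ((k : MvPolynomial (Fin n) ℝ) + (n : MvPolynomial (Fin n) ℝ) - 1) = C ((k : ℝ) + n - 1) := by simp
    rw [h, Ne, C_eq_zero]
    exact (gegenbauer_denom_pos hn k).ne'
  induction k using Nat.twoStepInduction with
  | zero => simp [zonal, dirDeriv_linForm x hx]
  | one =>
    apply mul_left_cancel₀ (ne 0)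
    rw [step 0]
    simp [zonal, dirDeriv_linForm x hx]
    ring
  | more k h0 h1 =>
    apply mul_left_cancel₀ (ne (k + 1))
    rw [step (k + 1), h0, h1]
    have := zonal_add_two hn x k
    push_cast
    linear_combination (-((k : MvPolynomial (Fin n) ℝ) + 2)) * this

lemma laplacian_zonal {n : ℕ} (hn : 2 ≤ n) (x : Fin n → ℝ) (hx : ∑ i, x i ^ 2 = 1) (k : ℕ) :
    laplacian (zonal x k) = 0 := by
  induction k using Nat.twoStepInduction with
  | zero => simp [zonal, laplacian_apply]
  | one => simp [zonal, laplacian_apply, pderiv_linForm]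
  | more k h0 h1 =>
    have hC : (C (2 : ℝ) : MvPolynomial (Fin n) ℝ) = 2 := map_ofNat C 2
    rw [zonal, map_smul, map_sub, map_smul, map_smul, laplacian_linForm_mul,
      laplacian_sumSq_mul (isHomogeneous_zonal x k), h0, h1, dirDeriv_zonal hn x hx]
    -- The two contributions are `(2k+n) * 2(k+1)` and `(k+1) * (2n+4k)` times `zonal x k`, and they
    -- cancel.
    convert smul_zero _
    simp [smul_eq_C_mul, hC]
    ring

/-- By adjointness the `sumSq` term of the recurrence meets `laplacian q = 0`, while `linForm x`
becomes `dirDeriv x`, which preserves harmonicity and lowers the degree; Euler's identity then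
evaluates at `x`. -/
lemma fischer_zonal {n : ℕ} (hn : 2 ≤ n) (k : ℕ) :
    ∃ γ : ℝ, 0 < γ ∧ ∀ (x : Fin n → ℝ) (q : MvPolynomial (Fin n) ℝ), q.IsHomogeneous k →
      laplacian q = 0 → fischer (zonal x k) q = γ * eval x q := by
  have const (x : Fin n → ℝ) (q : MvPolynomial (Fin n) ℝ) (hq : q.IsHomogeneous 0) :
      fischer 1 q = eval x q := by
    rw [← totalDegree_zero_iff_isHomogeneous, totalDegree_eq_zero_iff_eq_C] at hq
    rw [hq, ← C_1, ← monomial_zero', fischer_monomial]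
    simp
  have succ (k : ℕ) : ∃ γ : ℝ, 0 < γ ∧ ∀ (x : Fin n → ℝ) (q : MvPolynomial (Fin n) ℝ),
      q.IsHomogeneous (k + 1) → laplacian q = 0 →
      fischer (zonal x (k + 1)) q = γ * eval x q := by
    induction k with
    | zero =>
      refine ⟨1, one_pos, fun x q hq _ => ?_⟩
      have h := fischer_linForm_mul x 1 q
      rw [mul_one, const x _ (isHomogeneous_dirDeriv x hq), eval_dirDeriv x hq] at h
      simpa [zonal] using h
    | succ k ih =>
      obtain ⟨γ, hγ, h⟩ := ih
      have hd := gegenbauer_denom_pos hn k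
      have hn2 : (2 : ℝ) ≤ n := by exact_mod_cast hn
      -- The factor `k + 2` is the degree of `q`, from Euler's identity; the rest is the recurrence
      -- coefficient times the previous constant.
      refine ⟨((k : ℝ) + n - 1)⁻¹ * ((2 * (k : ℝ) + n) * (γ * (k + 2))), by positivity,
        fun x q hq hΔ => ?_⟩
      have hD := h x _ (isHomogeneous_dirDeriv x hq) (by rw [laplacian_dirDeriv, hΔ, map_zero])
      rw [eval_dirDeriv x hq] at hD
      rw [zonal]
      simp only [map_smul, map_sub, LinearMap.smul_apply, LinearMap.sub_apply,
        fischer_linForm_mul, fischer_sumSq_mul, hΔ, hD, map_zero, smul_eq_mul]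
      push_cast
      ring
  cases k with
  | zero => exact ⟨1, one_pos, fun x q hq _ => by simpa [zonal] using const x q hq⟩
  | succ k => exact succ k

lemma eval_zonal {n : ℕ} (x y : Sphere n) (k : ℕ) :
    eval (fun i => y.1 i) (zonal (fun i => x.1 i) k) = gegenbauer n k (dot x y) := by
  have hL : eval (fun i => y.1 i) (linForm fun i => x.1 i) = dot x y := by
    simp [linForm, dot, PiLp.inner_apply, mul_comm]
  have hR : eval (fun i => y.1 i) (sumSq n) = 1 := by
    have h := EuclideanSpace.real_norm_sq_eq y.1
    rw [norm_eq_of_mem_sphere] at h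
    simpa [sumSq] using h.symm
  induction k using Nat.twoStepInduction with
  | zero => simp [zonal, gegenbauer]
  | one => simp [zonal, gegenbauer, hL]
  | more k h0 h1 =>
    simp only [zonal, gegenbauer, smul_eval, map_sub, map_mul, h0, h1, hL, hR]
    rw [div_eq_inv_mul]
    ring

/-- Schoenberg's theorem: the Gegenbauer polynomials are positive definite on the sphere. -/
theorem sum_gegenbauer_nonneg {n : ℕ} (hn : 2 ≤ n) (k : ℕ) {ι : Type*} (s : Finset ι)
    (y : ι → Sphere n) : 0 ≤ ∑ i ∈ s, ∑ j ∈ s, gegenbauer n k (dot (y i) (y j)) := by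
  obtain ⟨γ, hγ, h⟩ := fischer_zonal hn k
  let Z : ι → MvPolynomial (Fin n) ℝ := fun i => zonal (fun a => (y i).1 a) k
  have hs (i : ι) : ∑ a, (y i).1 a ^ 2 = 1 := by
    rw [← EuclideanSpace.real_norm_sq_eq, norm_eq_of_mem_sphere, one_pow]
  have hZ (i j : ι) : fischer (Z j) (Z i) = γ * gegenbauer n k (dot (y i) (y j)) := by
    rw [h _ _ (isHomogeneous_zonal _ k) (laplacian_zonal hn _ (hs i) k), eval_zonal]
  -- The double sum, times `γ`, is the Fischer square of `∑ Z i`.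
  have hpos := fischer_self_nonneg (∑ i ∈ s, Z i)
  simp only [map_sum, LinearMap.sum_apply, hZ, ← Finset.mul_sum] at hpos
  exact nonneg_of_mul_nonneg_right hpos hγ

end

end SphericalFDesign

namespace SphericalFDesign

/-! ### Majorization of the zero sequence -/

lemma sumSmallest_eq_zero {A : Multiset ℝ} (hA : ∀ a ∈ A, a = 0) (k : ℕ) :
    sumSmallest A k = 0 :=
  List.sum_eq_zero fun a ha => hA a ((Multiset.mem_sort (· ≤ ·)).1 (List.mem_of_mem_take ha))

lemma sumSmallest_one_le {B : Multiset ℝ} {b : ℝ} (hb : b ∈ B) : sumSmallest B 1 ≤ b := by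
  have hs := Multiset.pairwise_sort B (· ≤ ·)
  have hm := (Multiset.mem_sort (s := B) (· ≤ ·)).2 hb
  unfold sumSmallest
  cases h : B.sort (· ≤ ·) with
  | nil => simp [h] at hm
  | cons a l =>
    rw [h] at hs hm
    rcases List.mem_cons.1 hm with rfl | hm
    · simp
    · simpa using (List.pairwise_cons.1 hs).1 b hm

lemma Majorizes.refl (A : Multiset ℝ) : Majorizes A A :=
  ⟨rfl, fun _ _ _ => le_rfl⟩

/-- A sequence with non-positive sum that majorizes a zero sequence equals it. -/
lemma Majorizes.eq_of_sum_nonpos {A B : Multiset ℝ} (h : Majorizes B A)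
    (hA : ∀ a ∈ A, a = 0) (hB : B.sum ≤ 0) : B = A := by
  have hnonneg : ∀ b ∈ B, 0 ≤ b := fun b hb => by
    -- Comparing the smallest entries alone makes all of `B` nonnegative.
    have h1 := h.2 1 le_rfl (Multiset.card_pos_iff_exists_mem.2 ⟨b, hb⟩)
    rw [sumSmallest_eq_zero hA] at h1
    exact h1.trans (sumSmallest_one_le hb)
  have hzero : ∀ b ∈ B, b = 0 := fun b hb =>
    le_antisymm ((Multiset.single_le_sum hnonneg b hb).trans hB) (hnonneg b hb)
  rw [Multiset.eq_replicate_card.2 hzero, Multiset.eq_replicate_card.2 hA, h.1]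

/-! ### Energies of configurations on the sphere -/

lemma dot_self {n : ℕ} (x : Sphere n) : dot x x = 1 := by
  rw [dot, real_inner_self_eq_norm_sq, norm_eq_of_mem_sphere, one_pow]

lemma dot_comm {n : ℕ} (x y : Sphere n) : dot x y = dot y x :=
  real_inner_comm _ _

lemma dot_mem_Icc {n : ℕ} (x y : Sphere n) : dot x y ∈ Set.Icc (-1 : ℝ) 1 := by
  have h := abs_real_inner_le_norm (x : EuclideanSpace ℝ (Fin n)) y
  rw [norm_eq_of_mem_sphere, norm_eq_of_mem_sphere, one_mul] at h
  exact abs_le.1 h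

open Filter Topology in
lemma HasGegenbauerSeries.tendsto_sum {n : ℕ} {f : ℝ → ℝ} {c : ℕ → ℝ}
    (hf : HasGegenbauerSeries n f c) {ι : Type*} (s : Finset ι) (y : ι → Sphere n) :
    Tendsto (fun N => ∑ k ∈ Finset.range N,
        c k * ∑ i ∈ s, ∑ j ∈ s, gegenbauer n k (dot (y i) (y j))) atTop
      (𝓝 (∑ i ∈ s, ∑ j ∈ s, f (dot (y i) (y j)))) := by
  have h := tendsto_finsetSum s fun i _ => tendsto_finsetSum s fun j _ =>
    hf.tendsto_at (dot_mem_Icc (y i) (y j))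
  refine h.congr fun N => ?_
  simp only [Finset.mul_sum]
  rw [Finset.sum_comm (s := Finset.range N)]
  exact Finset.sum_congr rfl fun i _ => Finset.sum_comm

/-- The energy of a configuration is bounded below by the contribution of the constant term. -/
lemma HasGegenbauerSeries.le_sum {n : ℕ} (hn : 2 ≤ n) {f : ℝ → ℝ} {c : ℕ → ℝ}
    (hf : HasGegenbauerSeries n f c) (hc : ∀ k, 0 ≤ c k) {ι : Type*} (s : Finset ι)
    (y : ι → Sphere n) : c 0 * (s.card : ℝ) ^ 2 ≤ ∑ i ∈ s, ∑ j ∈ s, f (dot (y i) (y j)) := by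
  refine ge_of_tendsto (hf.tendsto_sum s y) ?_
  -- From `N = 1` on, the partial sum contains the constant term, and the other terms are
  -- nonnegative.
  filter_upwards [Filter.eventually_ge_atTop 1] with N hN
  have h := Finset.single_le_sum (s := Finset.range N)
    (f := fun k => c k * ∑ i ∈ s, ∑ j ∈ s, gegenbauer n k (dot (y i) (y j)))
    (fun k _ => mul_nonneg (hc k) (sum_gegenbauer_nonneg hn k s y))
    (Finset.mem_range.2 hN)
  simpa [gegenbauer, pow_two] using h

/-- An `f`-design attains the lower bound on the energy. -/
lemma IsFDesign.sum_eq {n : ℕ} {f : ℝ → ℝ} {c : ℕ → ℝ} (hf : HasGegenbauerSeries n f c)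
    {P : Finset (Sphere n)} (hP : IsFDesign f c P) :
    ∑ p ∈ P, ∑ q ∈ P, f (dot p q) = c 0 * (P.card : ℝ) ^ 2 := by
  refine tendsto_nhds_unique (hf.tendsto_sum P id) (tendsto_const_nhds.congr' ?_)
  filter_upwards [Filter.eventually_ge_atTop 1] with N hN
  rw [Finset.sum_eq_single_of_mem 0 (Finset.mem_range.2 hN)]
  · simp [gegenbauer, pow_two]
  · intro k _ hk
    by_cases hck : c k = 0
    · simp [hck]
    · have h := hP.1 k (Nat.pos_of_ne_zero hk) hck
      rw [moment] at h
      simp [h]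

lemma IsFDesign.apply_dot_eq_zero {n : ℕ} {f : ℝ → ℝ} {c : ℕ → ℝ} {P : Finset (Sphere n)}
    (hP : IsFDesign f c P) {p q : Sphere n} (hp : p ∈ P) (hq : q ∈ P) (hpq : p ≠ q) :
    f (dot p q) = 0 :=
  (hP.2 ⟨p, hp, q, hq, hpq, rfl⟩).2

/-- With `IsFDesign.sum_eq` this turns the lower bound into `m * f 1`, the diagonal energy of any
`m` points. -/
lemma IsFDesign.sum_eq_card_mul {n : ℕ} {f : ℝ → ℝ} {c : ℕ → ℝ} {P : Finset (Sphere n)}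
    (hP : IsFDesign f c P) : ∑ p ∈ P, ∑ q ∈ P, f (dot p q) = P.card * f 1 := by
  rw [← nsmul_eq_mul, ← Finset.sum_const]
  refine Finset.sum_congr rfl fun p hp => ?_
  rw [Finset.sum_eq_single_of_mem p hp fun q hq hqp =>
    hP.apply_dot_eq_zero hp hq hqp.symm, dot_self]

lemma sum_univ_eq_add_two_mul_sum_lt {m : ℕ} (g : Fin m → Fin m → ℝ)
    (hg : ∀ i j, g i j = g j i) :
    ∑ i, ∑ j, g i j = ∑ i, g i i
      + 2 * ∑ p ∈ (Finset.univ : Finset (Fin m × Fin m)).filter (fun p => p.1 < p.2),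
        g p.1 p.2 := by
  simp only [Finset.sum_filter, Fintype.sum_prod_type]
  have hsw : ∑ i, ∑ j, (if i < j then g i j else 0) = ∑ i, ∑ j, (if j < i then g i j else 0) := by
    rw [Finset.sum_comm]
    exact Finset.sum_congr rfl fun i _ => Finset.sum_congr rfl fun j _ => by rw [hg]
  have hd : ∑ i, g i i = ∑ i, ∑ j, (if i = j then g i j else 0) := by simp
  rw [two_mul]
  nth_rewrite 2 [hsw]
  rw [hd]
  simp only [← Finset.sum_add_distrib]
  refine Finset.sum_congr rfl fun i _ => Finset.sum_congr rfl fun j _ => ?_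
  rcases lt_trichotomy i j with h | h | h
  · simp [h, h.ne, h.not_gt]
  · simp [h]
  · simp [h, h.ne', h.not_gt]

lemma sum_pairValues_neg {n m : ℕ} (f : ℝ → ℝ) (y : Fin m → Sphere n) :
    2 * (pairValues (fun x y => -f (dot x y)) y).sum
      = m * f 1 - ∑ i, ∑ j, f (dot (y i) (y j)) := by
  have h := sum_univ_eq_add_two_mul_sum_lt (fun i j => f (dot (y i) (y j)))
    (fun i j => by rw [dot_comm])
  simp only [dot_self, Finset.sum_const, Finset.card_univ, Fintype.card_fin, nsmul_eq_mul] at h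
  have h2 : (pairValues (fun x y => -f (dot x y)) y).sum
      = -∑ p ∈ (Finset.univ : Finset (Fin m × Fin m)).filter (fun p => p.1 < p.2),
        f (dot (y p.1) (y p.2)) := by
    rw [← Finset.sum_neg_distrib]
    rfl
  rw [h, h2]
  ring

end SphericalFDesign

theorem mainTheorem4 (n : ℕ) (hn : 2 ≤ n) (f : ℝ → ℝ) (c : ℕ → ℝ)
    (hf : SphericalFDesign.HasGegenbauerSeries n f c) (hc : ∀ k : ℕ, 0 ≤ c k)
    (P : Finset (SphericalFDesign.Sphere n)) (hP : SphericalFDesign.IsFDesign f c P) :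
    P ∈ SphericalFDesign.mSets (SphericalFDesign.Sphere n)
      (fun x y => - f (SphericalFDesign.dot x y)) P.card := by
  open SphericalFDesign in
  refine ⟨rfl, fun x y => ?_⟩
  have hzero : ∀ a ∈ pairValues (fun x y => -f (dot x y)) (fun i => (x i : Sphere n)),
      a = 0 := by
    intro a ha
    obtain ⟨p, hp, rfl⟩ := Multiset.mem_map.1 ha
    have hlt : p.1 < p.2 := (Finset.mem_filter.1 hp).2
    have hne : (x p.1 : Sphere n) ≠ x p.2 := fun h => hlt.ne (x.injective (Subtype.ext h))
    simp [hP.apply_dot_eq_zero (x p.1).2 (x p.2).2 hne]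
  have hsum : (pairValues (fun x y => -f (dot x y)) y).sum ≤ 0 := by
    have h1 := sum_pairValues_neg f y
    have h2 := hf.le_sum hn hc Finset.univ y
    rw [Finset.card_univ, Fintype.card_fin, ← hP.sum_eq hf, hP.sum_eq_card_mul] at h2
    linarith
  -- Only a competitor that majorizes the design could violate the claim, and it must have the same
  -- values.
  by_cases hYX : Majorizes (pairValues (fun x y => -f (dot x y)) y)
      (pairValues (fun x y => -f (dot x y)) (fun i => (x i : Sphere n)))
  · rw [hYX.eq_of_sum_nonpos hzero hsum]
    exact Or.inl (Majorizes.refl _)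
  · by_cases hXY : Majorizes (pairValues (fun x y => -f (dot x y)) (fun i => (x i : Sphere n)))
        (pairValues (fun x y => -f (dot x y)) y)
    · exact Or.inl hXY
    · exact Or.inr ⟨hXY, hYX⟩
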